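/- **Theorem 5.** Let $N, m \ge 1$ and $H\ge 0$ be integers (numbers of samples, of PV panels and of HVAC units), let $\xi^1,\dots,\xi^N\in\mathbb R^{m}$ be samples of the PV output, let $P_1,\dots,P_H\ge 0$ be the loads of the HVAC units, and let $\delta_t>0$. Fix a norm $\|\cdot\|$ on $\mathbb R^m$, write $\|\mathbf 1\|_*=\sup\{\mathbf 1^\top x:\|x\|\le 1\}$ for the dual norm of the all-ones vector, and set $\delta=\|\mathbf 1\|_*\,\delta_t$ (so $\delta=\delta_t$ when $m=1$ and the norm is the absolute value, or when the norm is the $\ell_1$-norm). Let $\mathcal D_t$ be the set of all probability distributions $f$ on $\mathbb R^m$ with $W(f,\widehat{\mathbb P}_N)\le\delta_t$, where $\widehat{\mathbb P}_N=\frac1N\sum_{n=1}^N\delta_{\xi^n}$ is the empirical distribution (here $\delta_{\xi^n}$ is the unit mass at $\xi^n$) and $W(\mu,\nu)=\inf_{\mathbb Q}\int\|x-y\|\,\mathbb Q(\mathrm dx,\mathrm dy)$ over all joint distributions $\mathbb Q$ with marginals $\mu,\nu$. Let $P^{(1)}\ge P^{(2)}\ge\dots\ge P^{(N)}$ be the total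 outputs $\mathbf 1^\top\xi^n$, $n=1,\dots,N$, sorted in non-increasing order, let $P^{(0)}=\sum_{\ell=1}^{H}P_\ell$, and assume that $P^{(0)}>P^{(N)}$. Let $u\in\{0,1\}^H$ and $\alpha_t\in[0,1)$. Then the distributionally robust chance constraint $$\inf_{f\in\mathcal D_t}\mathbb P_{\tilde x\sim f}\Bigl(\sum_{\ell=1}^{H}P_\ell u_\ell-\sum_{i=1}^m\tilde x_i\ge 0\Bigr)\ge 1-\alpha_t$$ holds if and only if there are reals $\Delta_{jk},\varepsilon_{jk},\tau_{\ell jk},o_{\ell jk}$ ($0\le j-1\le k\le N-1$, $1\le\ell\le H$) satisfying the following system, which contains no big-M coefficient and is linear in $(u,\alpha_t,\Delta,\varepsilon,\tau,o)$ apart from the integrality of $u$ and $\Delta$: 1. $\displaystyle\sum_{j=1}^N\sum_{k=j-1}^{N-1}\Bigl[-\frac1N\sum_{i=j}^k\bigl(P^{(k+1)}-P^{(i)}\bigr)\Delta_{jk}-\sum_{\ell=1}^{H}P_\ell\Bigl(o_{\ell jk}-\frac{j-1}N\tau_{\ell jk}\Bigr)+P^{(k+1)}\Bigl(\varepsilon_{jk}-\frac{j-1}N\Delta_{jk}\Bigr)\Bigr]\le-\delta$;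 2. $\sum_{j=1}^N\sum_{k=j-1}^{N-1}\Delta_{jk}=1$; 3. $\sum_{j=1}^N\sum_{k=j-1}^{N-1}k\Delta_{jk}\le\alpha_tN\le\sum_{j=1}^N\sum_{k=j-1}^{N-1}(k+1)\Delta_{jk}$; 4. $\sum_{j=1}^N\sum_{k=j-1}^{N-1}P^{(j)}\Delta_{jk}\le\sum_{\ell=1}^{H}P_\ell u_\ell\le\sum_{j=1}^N\sum_{k=j-1}^{N-1}P^{(j-1)}\Delta_{jk}$; 5. $\varepsilon_{jk}\le\Delta_{jk}$, $\varepsilon_{jk}\le\alpha_t$, $\varepsilon_{jk}\ge\alpha_t+\Delta_{jk}-1$, $\varepsilon_{jk}\ge0$ for $0\le j-1\le k\le N-1$; 6. $o_{\ell jk}\le\varepsilon_{jk}$, $o_{\ell jk}\le u_\ell$, $o_{\ell jk}\ge\varepsilon_{jk}+u_\ell-1$, $o_{\ell jk}\ge0$ for $0\le j-1\le k\le N-1$, $1\le\ell\le H$; 7. $\tau_{\ell jk}\le\Delta_{jk}$, $\tau_{\ell jk}\le u_\ell$, $\tau_{\ell jk}\ge\Delta_{jk}+u_\ell-1$, $\tau_{\ell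 jk}\ge0$ for $0\le j-1\le k\le N-1$, $1\le\ell\le H$; 8. $\Delta_{jk}\in\{0,1\}$ for $0\le j-1\le k\le N-1$. Moreover, every solution of this system satisfies $\varepsilon_{jk}=\alpha_t\Delta_{jk}$, $\tau_{\ell jk}=u_\ell\Delta_{jk}$ and $o_{\ell jk}=\alpha_tu_\ell\Delta_{jk}$ for all $0\le j-1\le k\le N-1$ and $1\le\ell\le H$. -/

import Mathlib

open MeasureTheory
open scoped ENNReal

noncomputable section

/-- The empirical distribution of the samples `ξ 0, …, ξ (N - 1)`: mass `1 / N` on each sample. -/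
def empiricalMeasure {N m : ℕ} (ξ : Fin N → Fin m → ℝ) : Measure (Fin m → ℝ) :=
  (N : ℝ≥0∞)⁻¹ • ∑ n, Measure.dirac (ξ n)

/-- The (type-1) Wasserstein distance between two distributions on `ℝᵐ`, with the norm `p` as
transportation cost: the infimum of the expected cost over all joint distributions with the two
given marginals. It may be infinite. -/
def wassersteinDist {m : ℕ} (p : Seminorm ℝ (Fin m → ℝ)) (μ ν : Measure (Fin m → ℝ)) : ℝ≥0∞ :=
  ⨅ (Q : Measure ((Fin m → ℝ) × (Fin m → ℝ))) (_ : Q.fst = μ ∧ Q.snd = ν),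
    ∫⁻ z, ENNReal.ofReal (p (z.1 - z.2)) ∂Q

/-- The Wasserstein ambiguity set: all probability distributions on `ℝᵐ` within distance `δ` of the
empirical distribution of the samples. -/
def wassersteinAmbiguitySet {N m : ℕ} (p : Seminorm ℝ (Fin m → ℝ)) (ξ : Fin N → Fin m → ℝ)
    (δ : ℝ) : Set (Measure (Fin m → ℝ)) :=
  {f | IsProbabilityMeasure f ∧ wassersteinDist p f (empiricalMeasure ξ) ≤ ENNReal.ofReal δ}

/-- The aggregated load of the units that are switched on. -/
def totalLoad {H : ℕ} (P u : Fin H → ℝ) : ℝ := ∑ l, P l * u l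

/-- The distributionally robust chance constraint: the worst-case probability, over the Wasserstein
ambiguity set, that the load covers the total PV output is at least `1 - α`. -/
def DRChanceConstraint {N m H : ℕ} (p : Seminorm ℝ (Fin m → ℝ)) (ξ : Fin N → Fin m → ℝ) (δ : ℝ)
    (P u : Fin H → ℝ) (α : ℝ) : Prop :=
  ENNReal.ofReal (1 - α) ≤
    ⨅ f ∈ wassersteinAmbiguitySet p ξ δ, f {x | totalLoad P u - ∑ i, x i ≥ 0}

/-- The dual norm of `c`: the supremum of `⟨c, x⟩` over the unit ball of the norm `p`. -/
def dualNorm {m : ℕ} (p : Seminorm ℝ (Fin m → ℝ)) (c : Fin m → ℝ) : ℝ :=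
  sSup ((fun x : Fin m → ℝ => ∑ i, c i * x i) '' {x | p x ≤ 1})

/-- The sorted total outputs `P⁽⁰⁾, P⁽¹⁾, …, P⁽ᴺ⁾`: `P⁽⁰⁾` is the load with every unit on, and for
`1 ≤ n ≤ N`, `P⁽ⁿ⁾` is the total output of the sample in position `n` of the ordering `σ`.
(The value for `n > N` is never used.) -/
def sortedTotal {N m H : ℕ} (P : Fin H → ℝ) (ξ : Fin N → Fin m → ℝ) (σ : Equiv.Perm (Fin N)) :
    ℕ → ℝ
  | 0 => ∑ l, P l
  | n + 1 => if h : n < N then ∑ i, ξ (σ ⟨n, h⟩) i else 0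

/-- The mixed-integer linear system in the decisions `u`, `α` and the auxiliary variables
`Δ j k`, `ε j k`, `τ l j k`, `o l j k` for `0 ≤ j - 1 ≤ k ≤ N - 1` (the values at other indices do
not occur). Its data are the number `N` of samples, the unit loads `P`, the sorted total outputs
`S 0, …, S N` and the radius `δ`. -/
structure AdjustableMILP {H : ℕ} (N : ℕ) (P : Fin H → ℝ) (S : ℕ → ℝ) (δ : ℝ)
    (u : Fin H → ℝ) (α : ℝ) (Δ ε : ℕ → ℕ → ℝ) (τ o : Fin H → ℕ → ℕ → ℝ) : Prop where
  cvar : ∑ j ∈ Finset.Icc 1 N, ∑ k ∈ Finset.Icc (j - 1) (N - 1),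
      (-(1 / (N : ℝ)) * ∑ i ∈ Finset.Icc j k, (S (k + 1) - S i) * Δ j k
        - ∑ l, P l * (o l j k - ((j : ℝ) - 1) / N * τ l j k)
        + S (k + 1) * (ε j k - ((j : ℝ) - 1) / N * Δ j k)) ≤ -δ
  select : ∑ j ∈ Finset.Icc 1 N, ∑ k ∈ Finset.Icc (j - 1) (N - 1), Δ j k = 1
  risk_lower : ∑ j ∈ Finset.Icc 1 N, ∑ k ∈ Finset.Icc (j - 1) (N - 1), (k : ℝ) * Δ j k ≤ α * N
  risk_upper : α * N ≤
    ∑ j ∈ Finset.Icc 1 N, ∑ k ∈ Finset.Icc (j - 1) (N - 1), ((k : ℝ) + 1) * Δ j k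
  load_lower : ∑ j ∈ Finset.Icc 1 N, ∑ k ∈ Finset.Icc (j - 1) (N - 1), S j * Δ j k ≤ totalLoad P u
  load_upper : totalLoad P u ≤
    ∑ j ∈ Finset.Icc 1 N, ∑ k ∈ Finset.Icc (j - 1) (N - 1), S (j - 1) * Δ j k
  mccormick_ε : ∀ j ∈ Finset.Icc 1 N, ∀ k ∈ Finset.Icc (j - 1) (N - 1),
    ε j k ≤ Δ j k ∧ ε j k ≤ α ∧ ε j k ≥ α + Δ j k - 1 ∧ ε j k ≥ 0
  mccormick_o : ∀ j ∈ Finset.Icc 1 N, ∀ k ∈ Finset.Icc (j - 1) (N - 1), ∀ l,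
    o l j k ≤ ε j k ∧ o l j k ≤ u l ∧ o l j k ≥ ε j k + u l - 1 ∧ o l j k ≥ 0
  mccormick_τ : ∀ j ∈ Finset.Icc 1 N, ∀ k ∈ Finset.Icc (j - 1) (N - 1), ∀ l,
    τ l j k ≤ Δ j k ∧ τ l j k ≤ u l ∧ τ l j k ≥ Δ j k + u l - 1 ∧ τ l j k ≥ 0
  binary : ∀ j ∈ Finset.Icc 1 N, ∀ k ∈ Finset.Icc (j - 1) (N - 1), Δ j k = 0 ∨ Δ j k = 1

end

/-!
Write `L` for the load, `D` for the dual norm of the all-ones vector, and `S 1 ≥ … ≥ S N` for the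
sorted total outputs. The distance of the sample in position `n` to the event that the total output
exceeds `L` is `(L - S n)⁺ / D`, so the least cost of moving the mass `α` of the empirical
distribution into that event is a fractional knapsack problem: move the samples of largest output
first. Its value, multiplied by `D`, is `tailCost`. The chance constraint holds exactly when the
budget `D δ` does not exceed it (`drChanceConstraint_iff_le_tailCost`):

* if `D δ ≤ tailCost`, the threshold `t = (L - S (k + 1))⁺` certifies the bound by weak duality
  (`measure_lt_le_of_mem_ambiguitySet`); here `D δ > 0` ensures `t > 0`;
* if `tailCost < D δ`, the remaining budget moves slightly more mass than `α`
  (`exists_mem_ambiguitySet_le_measure_lt`). The event is open and the dual norm is a supremum, so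
  the samples go a little beyond the boundary, along a nearly optimal direction.

In the mixed-integer system, the McCormick inequalities are exact because `Δ` and `u` are binary,
and the selection constraint picks one cell `(j, k)`, where `k ≤ α N ≤ k + 1` and
`S j ≤ L ≤ S (j - 1)`. The samples of index less than `j` cost nothing, and on that cell the budget
inequality says `D δ ≤ tailCost` (`cellCost_eq_tailCost`). Conversely, a positive cost forces
`S (k + 1) < L`, so that a suitable `j ≤ k + 1` exists.
-/

/-! ### The dual norm of the all-ones vector -/

theorem Seminorm.continuous_of_finite {m : ℕ} (p : Seminorm ℝ (Fin m → ℝ)) : Continuous p :=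
  p.convexOn.locallyLipschitz.continuous

/-- A norm on `ℝᵐ` dominates a positive multiple of the sup norm, so the supremum that defines the
dual norm is over a bounded set. -/
theorem bddAbove_dualNorm {m : ℕ} (p : Seminorm ℝ (Fin m → ℝ)) (hp : ∀ x, p x = 0 → x = 0)
    (c : Fin m → ℝ) :
    BddAbove ((fun x : Fin m → ℝ => ∑ i, c i * x i) '' {x | p x ≤ 1}) := by
  obtain ⟨r, hr, hball⟩ : ∃ r > 0, ∀ x : Fin m → ℝ, r * ‖x‖ ≤ p x := by
    rcases (Metric.sphere (0 : Fin m → ℝ) 1).eq_empty_or_nonempty with hs | hs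
    · refine ⟨1, one_pos, fun x => ?_⟩
      have : x = 0 := by
        by_contra hx
        have : ‖x‖⁻¹ • x ∈ Metric.sphere (0 : Fin m → ℝ) 1 := by
          simp [norm_smul, norm_ne_zero_iff.mpr hx]
        simp [hs] at this
      simp [this]
    · obtain ⟨y, hy, hmin⟩ := (isCompact_sphere (0 : Fin m → ℝ) 1).exists_isMinOn hs
        p.continuous_of_finite.continuousOn
      have hy0 : y ≠ 0 := by rintro rfl; simp at hy
      refine ⟨p y, lt_of_le_of_ne (apply_nonneg p y) fun h => hy0 (hp y h.symm), fun x => ?_⟩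
      rcases eq_or_ne x 0 with rfl | hx
      · simp
      have hxn : 0 < ‖x‖ := norm_pos_iff.mpr hx
      have : p y ≤ p (‖x‖⁻¹ • x) := hmin (by simp [norm_smul, hxn.ne'])
      rw [map_smul_eq_mul, norm_inv, norm_norm, inv_mul_eq_div, le_div_iff₀ hxn] at this
      exact this
  refine ⟨∑ i, |c i| * r⁻¹, ?_⟩
  rintro _ ⟨x, hx, rfl⟩
  refine Finset.sum_le_sum fun i _ => (le_abs_self _).trans ?_
  rw [abs_mul]
  gcongr
  rw [← one_div, le_div_iff₀ hr, mul_comm]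
  calc r * |x i| ≤ r * ‖x‖ := by gcongr; exact norm_le_pi_norm x i
    _ ≤ p x := hball x
    _ ≤ 1 := hx

theorem sum_mul_le_dualNorm_mul {m : ℕ} (p : Seminorm ℝ (Fin m → ℝ)) (hp : ∀ x, p x = 0 → x = 0)
    (c x : Fin m → ℝ) : ∑ i, c i * x i ≤ dualNorm p c * p x := by
  rcases (apply_nonneg p x).eq_or_lt with h | h
  · simp [hp x h.symm]
  have : ∑ i, c i * ((p x)⁻¹ • x) i ≤ dualNorm p c :=
    le_csSup (bddAbove_dualNorm p hp c)
      ⟨_, by simp [map_smul_eq_mul, abs_of_pos h, h.ne'], rfl⟩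
  rw [← div_le_iff₀ h, Finset.sum_div]
  refine le_of_eq_of_le (Finset.sum_congr rfl fun i _ => ?_) this
  simp only [Pi.smul_apply, smul_eq_mul]
  field_simp

theorem dualNorm_one_pos {m : ℕ} (hm : 0 < m) (p : Seminorm ℝ (Fin m → ℝ))
    (hp : ∀ x, p x = 0 → x = 0) : 0 < dualNorm p (fun _ => 1) := by
  have h := sum_mul_le_dualNorm_mul p hp (fun _ => 1) (fun _ => 1)
  have hm' : (0 : ℝ) < m := by exact_mod_cast hm
  simp only [mul_one, Finset.sum_const, Finset.card_univ, Fintype.card_fin, nsmul_eq_mul] at h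
  exact pos_of_mul_pos_left (hm'.trans_le h) (apply_nonneg p _)

/-! ### The Wasserstein ambiguity set -/

theorem empiricalMeasure_comp_perm {N m : ℕ} (ξ : Fin N → Fin m → ℝ) (σ : Equiv.Perm (Fin N)) :
    empiricalMeasure (ξ ∘ σ) = empiricalMeasure ξ := by
  unfold empiricalMeasure
  congr 1
  exact Equiv.sum_comp σ fun n => Measure.dirac (ξ n)

theorem lintegral_empiricalMeasure {N m : ℕ} (ξ : Fin N → Fin m → ℝ) (g : (Fin m → ℝ) → ℝ)
    (hg : ∀ x, 0 ≤ g x) :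
    ∫⁻ x, ENNReal.ofReal (g x) ∂empiricalMeasure ξ = ENNReal.ofReal (1 / N * ∑ n, g (ξ n)) := by
  rcases N.eq_zero_or_pos with rfl | hN
  · simp [empiricalMeasure]
  rw [empiricalMeasure, lintegral_smul_measure, lintegral_finsetSum_measure,
    ENNReal.ofReal_mul (by positivity), ENNReal.ofReal_sum_of_nonneg fun n _ => hg _, one_div,
    ENNReal.ofReal_inv_of_pos (by exact_mod_cast hN)]
  simp

/-- Weak duality for the worst-case probability: any threshold `t > 0` gives an upper bound on the
probability that the total output exceeds `L`. On that event the transport cost from a sample `y`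
is at least `(L - ∑ i, y i)⁺` divided by the dual norm of the all-ones vector. -/
theorem measure_lt_le_of_mem_ambiguitySet {N m : ℕ} (p : Seminorm ℝ (Fin m → ℝ))
    (hp : ∀ x, p x = 0 → x = 0) (ξ : Fin N → Fin m → ℝ) {δ : ℝ} (hδ : 0 ≤ δ) (L : ℝ) {α t : ℝ}
    (ht : 0 < t)
    (h : dualNorm p (fun _ => 1) * δ
      + 1 / N * ∑ n, max 0 (t - max 0 (L - ∑ i, ξ n i)) ≤ α * t)
    {f : Measure (Fin m → ℝ)} (hf : f ∈ wassersteinAmbiguitySet p ξ δ) :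
    f {x | L < ∑ i, x i} ≤ ENNReal.ofReal α := by
  set D := dualNorm p (fun _ => 1)
  have hD : 0 ≤ D := Real.sSup_nonneg' ⟨0, ⟨0, by simp, by simp⟩, le_rfl⟩
  have hV : MeasurableSet {x : Fin m → ℝ | L < ∑ i, x i} :=
    measurableSet_lt measurable_const (by fun_prop)
  have hpm : Measurable p := p.continuous_of_finite.measurable
  set r : (Fin m → ℝ) → ℝ := fun y => max 0 (t - max 0 (L - ∑ i, y i)) with hr
  have hr0 : ∀ y, 0 ≤ r y := fun y => le_max_left _ _
  have hrm : Measurable r := by fun_prop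
  have key : ENNReal.ofReal t * f {x | L < ∑ i, x i} ≤ ENNReal.ofReal t * ENNReal.ofReal α := by
    have step : ∀ C : ℝ≥0∞, wassersteinDist p f (empiricalMeasure ξ) < C →
        ENNReal.ofReal t * f {x | L < ∑ i, x i} ≤
          ENNReal.ofReal D * C + ENNReal.ofReal (1 / N * ∑ n, r (ξ n)) := by
      intro C hC
      obtain ⟨Q, hQ⟩ := iInf_lt_iff.mp hC
      obtain ⟨⟨hQ1, hQ2⟩, hQC⟩ := iInf_lt_iff.mp hQ
      rw [← lintegral_empiricalMeasure ξ r hr0, ← hQ1, ← hQ2, Measure.fst_apply hV, Measure.snd,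
        lintegral_map (by fun_prop) measurable_snd,
        ← lintegral_indicator_const (measurable_fst hV)]
      calc _ ≤ ∫⁻ z, (ENNReal.ofReal D * ENNReal.ofReal (p (z.1 - z.2))
              + ENNReal.ofReal (r z.2)) ∂Q := by
            refine lintegral_mono fun z => ?_
            refine Set.indicator_apply_le' (fun hz => ?_) fun _ => bot_le
            rw [← ENNReal.ofReal_mul hD, ← ENNReal.ofReal_add
              (mul_nonneg hD (apply_nonneg p _)) (hr0 _)]
            refine ENNReal.ofReal_le_ofReal ?_
            have h1 := sum_mul_le_dualNorm_mul p hp (fun _ => 1) (z.1 - z.2)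
            simp only [one_mul, Pi.sub_apply, Finset.sum_sub_distrib] at h1
            have h2 : L < ∑ i, z.1 i := hz
            have h3 : t - max 0 (L - ∑ i, z.2 i) ≤ r z.2 := le_max_right _ _
            have h4 : max 0 (L - ∑ i, z.2 i) ≤ D * p (z.1 - z.2) :=
              max_le (mul_nonneg hD (apply_nonneg p _)) (by linarith)
            linarith
        _ = ENNReal.ofReal D * ∫⁻ z, ENNReal.ofReal (p (z.1 - z.2)) ∂Q
              + ∫⁻ z, ENNReal.ofReal (r z.2) ∂Q := by
            rw [lintegral_add_left (by fun_prop), lintegral_const_mul _ (by fun_prop)]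
        _ ≤ _ := by gcongr
    have step' : ENNReal.ofReal t * f {x | L < ∑ i, x i} ≤
        ENNReal.ofReal D * ENNReal.ofReal δ + ENNReal.ofReal (1 / N * ∑ n, r (ξ n)) := by
      have hlim : Filter.Tendsto
          (fun C : ℝ≥0∞ => ENNReal.ofReal D * C + ENNReal.ofReal (1 / N * ∑ n, r (ξ n)))
          (nhdsWithin (ENNReal.ofReal δ) (Set.Ioi (ENNReal.ofReal δ)))
          (nhds (ENNReal.ofReal D * ENNReal.ofReal δ + ENNReal.ofReal (1 / N * ∑ n, r (ξ n)))) :=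
        ((ENNReal.Tendsto.const_mul Filter.tendsto_id
          (Or.inr ENNReal.ofReal_ne_top)).add tendsto_const_nhds).mono_left nhdsWithin_le_nhds
      have : (nhdsWithin (ENNReal.ofReal δ) (Set.Ioi (ENNReal.ofReal δ))).NeBot :=
        nhdsGT_neBot_of_exists_gt ⟨⊤, ENNReal.ofReal_lt_top⟩
      refine ge_of_tendsto hlim ?_
      filter_upwards [self_mem_nhdsWithin] with C hC
      exact step C (hf.2.trans_lt hC)
    refine step'.trans ?_
    rw [← ENNReal.ofReal_mul hD, ← ENNReal.ofReal_mul ht.le, ← ENNReal.ofReal_add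
      (mul_nonneg hD hδ) (mul_nonneg (by positivity) (Finset.sum_nonneg fun n _ => hr0 _))]
    exact ENNReal.ofReal_le_ofReal (by rw [mul_comm t]; exact h)
  exact (ENNReal.mul_le_mul_iff_right (by simpa using ht) ENNReal.ofReal_ne_top).mp key

/-- Moving the fraction `w n` of the mass at the sample `ξ n` along a direction `v` of at most unit
length, just past the hyperplane where the total output is `L`, gives a member of the ambiguity set
under which the total output exceeds `L` with probability at least the average of `w`. -/
theorem exists_mem_ambiguitySet_le_measure_lt {N m : ℕ} (hN : 0 < N)
    (p : Seminorm ℝ (Fin m → ℝ)) (ξ : Fin N → Fin m → ℝ) {δ : ℝ} (L : ℝ)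
    {v : Fin m → ℝ} (hv : p v ≤ 1) (ha : 0 < ∑ i, v i) {η : ℝ} (hη : 0 < η)
    {w : Fin N → ℝ} (hw0 : ∀ n, 0 ≤ w n) (hw1 : ∀ n, w n ≤ 1)
    (h : 1 / N * ∑ n, w n * (max 0 (L - ∑ i, ξ n i) + η) ≤ (∑ i, v i) * δ) :
    ∃ f ∈ wassersteinAmbiguitySet p ξ δ,
      ENNReal.ofReal (1 / N * ∑ n, w n) ≤ f {x | L < ∑ i, x i} := by
  set a := ∑ i, v i
  have hN0 : (N : ℝ≥0∞) ≠ 0 := by exact_mod_cast hN.ne'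
  have hNinv : ENNReal.ofReal (1 / N) = (N : ℝ≥0∞)⁻¹ := by
    rw [one_div, ENNReal.ofReal_inv_of_pos (by exact_mod_cast hN), ENNReal.ofReal_natCast]
  have hw : ∀ n, ENNReal.ofReal (w n) + ENNReal.ofReal (1 - w n) = 1 := fun n => by
    rw [← ENNReal.ofReal_add (hw0 n) (by linarith [hw1 n])]; simp
  set s : Fin N → ℝ := fun n => (max 0 (L - ∑ i, ξ n i) + η) / a with hs
  have hs0 : ∀ n, 0 ≤ s n := fun n => by positivity
  set Q : Measure ((Fin m → ℝ) × (Fin m → ℝ)) := (N : ℝ≥0∞)⁻¹ • ∑ n,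
    (ENNReal.ofReal (w n) • Measure.dirac (ξ n + s n • v, ξ n)
      + ENNReal.ofReal (1 - w n) • Measure.dirac (ξ n, ξ n)) with hQ
  have hsnd : Q.snd = empiricalMeasure ξ := by
    ext A hA
    rw [Measure.snd_apply hA, hQ, empiricalMeasure]
    simp only [Measure.smul_apply, Measure.finsetSum_apply, Measure.add_apply, smul_eq_mul,
      Measure.dirac_apply' _ (measurable_snd hA), Measure.dirac_apply' _ hA]
    congr 1
    refine Finset.sum_congr rfl fun n _ => ?_
    change _ * A.indicator 1 (ξ n) + _ * A.indicator 1 (ξ n) = _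
    rw [← add_mul, hw, one_mul]
  have hV : MeasurableSet {x : Fin m → ℝ | L < ∑ i, x i} :=
    measurableSet_lt measurable_const (by fun_prop)
  refine ⟨Q.fst, ⟨⟨?_⟩, ?_⟩, ?_⟩
  · rw [Measure.fst_univ, ← Measure.snd_univ, hsnd, empiricalMeasure]
    simp [ENNReal.inv_mul_cancel hN0]
  · refine (iInf₂_le Q ⟨rfl, hsnd⟩).trans ?_
    have hpm : Measurable p := p.continuous_of_finite.measurable
    have hcost : ∀ n, ENNReal.ofReal (w n) * ENNReal.ofReal (p (ξ n + s n • v - ξ n))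
        ≤ ENNReal.ofReal (w n * s n) := fun n => by
      rw [← ENNReal.ofReal_mul (hw0 n), add_sub_cancel_left, map_smul_eq_mul,
        Real.norm_of_nonneg (hs0 n)]
      refine ENNReal.ofReal_le_ofReal (mul_le_mul_of_nonneg_left ?_ (hw0 n))
      exact mul_le_of_le_one_right (hs0 n) hv
    rw [hQ, lintegral_smul_measure, lintegral_finsetSum_measure]
    simp only [lintegral_add_measure, lintegral_smul_measure, lintegral_dirac, smul_eq_mul,
      sub_self, map_zero, ENNReal.ofReal_zero, mul_zero, add_zero]
    calc _ ≤ (N : ℝ≥0∞)⁻¹ * ∑ n, ENNReal.ofReal (w n * s n) := by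
          gcongr with n; exact hcost n
      _ = ENNReal.ofReal (1 / N * ∑ n, w n * s n) := by
          rw [ENNReal.ofReal_mul (by positivity), hNinv,
            ENNReal.ofReal_sum_of_nonneg fun n _ => mul_nonneg (hw0 n) (hs0 n)]
      _ ≤ ENNReal.ofReal δ := by
          refine ENNReal.ofReal_le_ofReal ?_
          have : 1 / (N : ℝ) * ∑ n, w n * s n
              = (1 / N * ∑ n, w n * (max 0 (L - ∑ i, ξ n i) + η)) / a := by
            rw [mul_div_assoc, Finset.sum_div]
            simp only [hs, mul_div_assoc]
          rw [this, div_le_iff₀ ha, mul_comm δ]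
          exact h
  · rw [Measure.fst_apply hV, hQ, ENNReal.ofReal_mul (by positivity), hNinv,
      ENNReal.ofReal_sum_of_nonneg fun n _ => hw0 n]
    simp only [Measure.smul_apply, Measure.finsetSum_apply, Measure.add_apply, smul_eq_mul,
      Measure.dirac_apply' _ (measurable_fst hV)]
    gcongr with n
    have hmem : (ξ n + s n • v, ξ n) ∈ Prod.fst ⁻¹' {x : Fin m → ℝ | L < ∑ i, x i} := by
      have h1 : s n * a = max 0 (L - ∑ i, ξ n i) + η := div_mul_cancel₀ _ ha.ne'
      have h2 := le_max_right 0 (L - ∑ i, ξ n i)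
      simp only [Set.mem_preimage, Set.mem_ofPred_eq, Pi.add_apply, Pi.smul_apply, smul_eq_mul,
        Finset.sum_add_distrib, ← Finset.mul_sum]
      change L < _ + s n * a
      linarith
    rw [Set.indicator_of_mem hmem]
    simp

/-! ### The chance constraint and the cost of moving mass `α` -/

/-- The least cost, in units of total output, of pushing the mass `α` beyond the level `L`, when
`k ≤ α N ≤ k + 1` and `S 1 ≥ S 2 ≥ …` are the total outputs of the `N` samples: the `k` samples of
largest output are moved entirely, and the next one in part. -/
noncomputable def tailCost (N : ℕ) (S : ℕ → ℝ) (L α : ℝ) (k : ℕ) : ℝ :=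
  1 / N * ∑ i ∈ Finset.range k, max 0 (L - S (i + 1)) + (α - k / N) * max 0 (L - S (k + 1))

theorem sum_range_ite_lt_eq_mul {N k : ℕ} (hk : k < N) (x : ℝ) (h : ℕ → ℝ) :
    ∑ i ∈ Finset.range N, (if i < k then 1 else if i = k then x else 0) * h i
      = ∑ i ∈ Finset.range k, h i + x * h k := by
  rw [← Finset.sum_subset (Finset.range_subset_range.mpr (Nat.succ_le_of_lt hk)),
    Finset.sum_range_succ]
  · congr 1
    · exact Finset.sum_congr rfl fun i hi => by rw [if_pos (Finset.mem_range.mp hi), one_mul]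
    · simp
  · intro i _ hi
    have : k < i := by simpa using hi
    rw [if_neg (by omega), if_neg (by omega), zero_mul]

/-- The optimal threshold in the dual bound is the cost of the sample moved in part. -/
theorem measure_lt_le_of_le_tailCost {N m k : ℕ} (p : Seminorm ℝ (Fin m → ℝ))
    (hp : ∀ x, p x = 0 → x = 0) (ξ : Fin N → Fin m → ℝ) {S : ℕ → ℝ}
    (hS : ∀ n : Fin N, S (n + 1) = ∑ i, ξ n i)
    (hanti : ∀ i j, i ≤ j → j < N → S (j + 1) ≤ S (i + 1))
    {δ : ℝ} (hδ : 0 ≤ δ) (hDδ : 0 < dualNorm p (fun _ => 1) * δ) (L : ℝ) {α : ℝ} (hk : k < N)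
    (h : dualNorm p (fun _ => 1) * δ ≤ tailCost N S L α k)
    {f : Measure (Fin m → ℝ)} (hf : f ∈ wassersteinAmbiguitySet p ξ δ) :
    f {x | L < ∑ i, x i} ≤ ENNReal.ofReal α := by
  set c : ℕ → ℝ := fun i => max 0 (L - S (i + 1)) with hc
  have hc0 : ∀ i, 0 ≤ c i := fun i => le_max_left _ _
  have hmono : ∀ i j, i ≤ j → j < N → c i ≤ c j := fun i j hij hj =>
    max_le_max le_rfl (by linarith [hanti i j hij hj])
  have hN : (0 : ℝ) < N := by exact_mod_cast (Nat.zero_le k).trans_lt hk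
  have hcost : tailCost N S L α k = 1 / N * ∑ i ∈ Finset.range k, c i + (α - k / N) * c k := rfl
  have ht : 0 < c k := by
    refine (hc0 k).lt_of_ne fun h0 => ?_
    have : ∑ i ∈ Finset.range k, c i = 0 := Finset.sum_eq_zero fun i hi =>
      le_antisymm ((hmono i k (Finset.mem_range.mp hi).le hk).trans h0.ge) (hc0 i)
    rw [hcost, this, ← h0] at h
    linarith
  refine measure_lt_le_of_mem_ambiguitySet p hp ξ hδ L ht ?_ hf
  have hsum : ∑ n : Fin N, max 0 (c k - max 0 (L - ∑ i, ξ n i))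
      = k * c k - ∑ i ∈ Finset.range k, c i := by
    simp only [← hS]
    rw [Fin.sum_univ_eq_sum_range (fun n => max 0 (c k - c n)) N,
      ← Finset.sum_subset (Finset.range_subset_range.mpr hk.le)]
    · rw [Finset.sum_congr rfl fun i hi => max_eq_right
        (sub_nonneg.mpr (hmono i k (Finset.mem_range.mp hi).le hk))]
      simp
    · intro i hi hik
      exact max_eq_left (sub_nonpos.mpr
        (hmono k i (by simpa using hik) (Finset.mem_range.mp hi)))
  rw [hsum]
  rw [hcost] at h
  have : 1 / (N : ℝ) * (k * c k - ∑ i ∈ Finset.range k, c i)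
      = k / N * c k - 1 / N * ∑ i ∈ Finset.range k, c i := by ring
  linarith

/-- Below the budget, slightly more mass than `α` can be pushed beyond the level `L`. -/
theorem exists_mem_ambiguitySet_lt_measure {N m k : ℕ} (p : Seminorm ℝ (Fin m → ℝ))
    (ξ : Fin N → Fin m → ℝ) {S : ℕ → ℝ} (hS : ∀ n : Fin N, S (n + 1) = ∑ i, ξ n i)
    {δ : ℝ} (hδ : 0 < δ) (L : ℝ) {α : ℝ} (hk : k < N) (hkα : k ≤ α * N) (hαk : α * N < k + 1)
    (h : tailCost N S L α k < dualNorm p (fun _ => 1) * δ) :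
    ∃ f ∈ wassersteinAmbiguitySet p ξ δ, ∃ β, α < β ∧
      ENNReal.ofReal β ≤ f {x | L < ∑ i, x i} := by
  set c : ℕ → ℝ := fun i => max 0 (L - S (i + 1)) with hc
  have hc0 : ∀ i, 0 ≤ c i := fun i => le_max_left _ _
  have hN : (0 : ℝ) < N := by exact_mod_cast (Nat.zero_le k).trans_lt hk
  have hN1 : (1 : ℝ) ≤ N := by exact_mod_cast (Nat.zero_le k).trans_lt hk
  have hk1 : (k : ℝ) + 1 ≤ N := by exact_mod_cast hk
  set g := tailCost N S L α k with hg
  have hcost : g = 1 / N * ∑ i ∈ Finset.range k, c i + (α - k / N) * c k := rfl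
  have hg0 : 0 ≤ g := by
    rw [hcost]
    have : 0 ≤ α - k / N := by rw [sub_nonneg, div_le_iff₀ hN]; exact hkα
    have := Finset.sum_nonneg fun i (_ : i ∈ Finset.range k) => hc0 i
    have := hc0 k
    positivity
  obtain ⟨_, ⟨v, hv, rfl⟩, hgv⟩ := exists_lt_of_lt_csSup (s := (fun x : Fin m → ℝ =>
    ∑ i, (1 : ℝ) * x i) '' {x | p x ≤ 1}) ⟨0, 0, by simp, by simp⟩ ((div_lt_iff₀ hδ).mpr h)
  simp only [one_mul] at hgv
  have ha : 0 < ∑ i, v i := (div_nonneg hg0 hδ.le).trans_lt hgv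
  rw [div_lt_iff₀ hδ] at hgv
  -- the excess mass is small enough not to exhaust sample `k` or the slack in the budget
  set θ := min (k + 1 - α * N) (((∑ i, v i) * δ - g) / (c k + 1)) with hθ
  have hck : 0 < c k + 1 := by linarith [hc0 k]
  have hθ0 : 0 < θ := lt_min (by linarith) (div_pos (by linarith) hck)
  have hθ1 : θ ≤ k + 1 - α * N := min_le_left _ _
  have hθ2 : θ * (c k + 1) ≤ (∑ i, v i) * δ - g := (le_div_iff₀ hck).mp (min_le_right _ _)
  set w : ℕ → ℝ := fun i => if i < k then 1 else if i = k then α * N - k + θ else 0 with hw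
  have hwsum : ∀ h : ℕ → ℝ, ∑ n : Fin N, w n * h n
      = ∑ i ∈ Finset.range k, h i + (α * N - k + θ) * h k := fun h => by
    rw [Fin.sum_univ_eq_sum_range (fun n => w n * h n) N]
    exact sum_range_ite_lt_eq_mul hk _ h
  obtain ⟨f, hf, hfV⟩ := exists_mem_ambiguitySet_le_measure_lt (by omega) p ξ (δ := δ) L hv ha hθ0
    (w := fun n : Fin N => w n) (fun n => by simp only [hw]; split_ifs <;> linarith)
    (fun n => by simp only [hw]; split_ifs <;> linarith) (by
      simp only [← hS]
      rw [hwsum fun i => c i + θ, Finset.sum_add_distrib, Finset.sum_const, Finset.card_range,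
        nsmul_eq_mul]
      have e : 1 / (N : ℝ) * (∑ i ∈ Finset.range k, c i + k * θ + (α * N - k + θ) * (c k + θ))
          = g + (θ * c k + (α * N + θ) * θ) / N := by
        rw [hcost]; field_simp; ring
      have e2 : (θ * c k + (α * N + θ) * θ) / N ≤ θ * (c k + 1) := by
        rw [div_le_iff₀ hN]
        have h1 : θ * c k ≤ θ * c k * N := le_mul_of_one_le_right (by have := hc0 k; positivity) hN1
        have h2 : (α * N + θ) * θ ≤ N * θ := by gcongr; linarith
        linarith
      rw [e]; linarith)
  refine ⟨f, hf, _, ?_, hfV⟩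
  have := hwsum fun _ => 1
  simp only [mul_one, Finset.sum_const, Finset.card_range, nsmul_eq_mul] at this
  rw [this, one_div, inv_mul_eq_div, lt_div_iff₀ hN]
  linarith

/-- The chance constraint says that the budget does not suffice to move more mass than `α`. -/
theorem drChanceConstraint_iff_le_tailCost {N m H : ℕ} (hN : 0 < N) (p : Seminorm ℝ (Fin m → ℝ))
    (hp : ∀ x, p x = 0 → x = 0) (ξ : Fin N → Fin m → ℝ) {S : ℕ → ℝ}
    (hS : ∀ n : Fin N, S (n + 1) = ∑ i, ξ n i)
    (hanti : ∀ i j, i ≤ j → j < N → S (j + 1) ≤ S (i + 1))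
    {δ : ℝ} (hδ : 0 < δ) (hD : 0 < dualNorm p (fun _ => 1)) (P u : Fin H → ℝ) {α : ℝ}
    (hα0 : 0 ≤ α) (hα1 : α < 1) :
    DRChanceConstraint p ξ δ P u α ↔ ∃ k < N, (k : ℝ) ≤ α * N ∧ α * N ≤ k + 1 ∧
      dualNorm p (fun _ => 1) * δ ≤ tailCost N S (totalLoad P u) α k := by
  set L := totalLoad P u
  have hV : MeasurableSet {x : Fin m → ℝ | L < ∑ i, x i} :=
    measurableSet_lt measurable_const (by fun_prop)
  have hsafe : {x : Fin m → ℝ | L - ∑ i, x i ≥ 0} = {x | L < ∑ i, x i}ᶜ := by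
    ext x; simp
  have hcompl : ∀ f ∈ wassersteinAmbiguitySet p ξ δ,
      f {x | L - ∑ i, x i ≥ 0} = 1 - f {x | L < ∑ i, x i} := fun f hf => by
    have := hf.1
    rw [hsafe, prob_compl_eq_one_sub hV]
  have hNR : (0 : ℝ) < N := by exact_mod_cast hN
  constructor
  · intro h
    have hfl := Nat.floor_le (mul_nonneg hα0 hNR.le)
    have hfl' := Nat.lt_floor_add_one (α * N)
    have hk : ⌊α * N⌋₊ < N := (Nat.floor_lt' hN.ne').mpr (by nlinarith)
    refine ⟨⌊α * N⌋₊, hk, hfl, hfl'.le, ?_⟩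
    by_contra! hlt
    obtain ⟨f, hf, β, hβ, hfV⟩ :=
      exists_mem_ambiguitySet_lt_measure p ξ hS hδ L hk hfl hfl' hlt
    have h1 := h.trans (iInf₂_le f hf)
    rw [hcompl f hf] at h1
    have h2 : ENNReal.ofReal (1 - α) ≤ ENNReal.ofReal (1 - β) := by
      refine h1.trans ?_
      rw [ENNReal.ofReal_sub _ (hα0.trans hβ.le), ENNReal.ofReal_one]
      exact tsub_le_tsub_left hfV 1
    have h3 := (ENNReal.ofReal_lt_ofReal_iff (by linarith : 0 < 1 - α)).mpr
      (by linarith : 1 - β < 1 - α)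
    exact absurd h2 h3.not_ge
  · rintro ⟨k, hk, -, -, h⟩
    refine le_iInf₂ fun f hf => ?_
    rw [hcompl f hf, ENNReal.ofReal_sub _ hα0, ENNReal.ofReal_one]
    exact tsub_le_tsub_left
      (measure_lt_le_of_le_tailCost p hp ξ hS hanti hδ.le (mul_pos hD hδ) L hk h hf) 1

/-! ### The mixed-integer system -/

/-- McCormick's inequalities are exact when one of the two factors is binary. -/
theorem AdjustableMILP.products_eq {H N : ℕ} {P : Fin H → ℝ} {S : ℕ → ℝ} {δ : ℝ} {u : Fin H → ℝ}
    (hu : ∀ l, u l = 0 ∨ u l = 1) {α : ℝ} {Δ ε : ℕ → ℕ → ℝ} {τ o : Fin H → ℕ → ℕ → ℝ}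
    (h : AdjustableMILP N P S δ u α Δ ε τ o) {j k : ℕ} (hj : j ∈ Finset.Icc 1 N)
    (hk : k ∈ Finset.Icc (j - 1) (N - 1)) :
    ε j k = α * Δ j k ∧ ∀ l, τ l j k = u l * Δ j k ∧ o l j k = α * u l * Δ j k := by
  obtain ⟨e1, e2, e3, e4⟩ := h.mccormick_ε j hj k hk
  have hε : ε j k = α * Δ j k := by
    rcases h.binary j hj k hk with hΔ | hΔ <;> rw [hΔ] at e1 e3 ⊢ <;> linarith
  refine ⟨hε, fun l => ?_⟩
  obtain ⟨o1, o2, o3, o4⟩ := h.mccormick_o j hj k hk l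
  obtain ⟨t1, t2, t3, t4⟩ := h.mccormick_τ j hj k hk l
  rcases hu l with hul | hul <;> rw [hul] at o2 o3 t2 t3 ⊢ <;> constructor <;> linarith

/-- The multiple of `Δ j k` in the budget inequality of the system, once the auxiliary variables are
replaced by the products that they stand for; it is written for the load `L`. -/
noncomputable def cellCost (N : ℕ) (S : ℕ → ℝ) (L α : ℝ) (j k : ℕ) : ℝ :=
  (L - S (k + 1)) * (α - ((j : ℝ) - 1) / N) + 1 / N * ∑ i ∈ Finset.Icc j k, (S (k + 1) - S i)

theorem budget_term_eq {H N : ℕ} (P u : Fin H → ℝ) (S : ℕ → ℝ) (α d : ℝ) (j k : ℕ) {e : ℝ}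
    {t o : Fin H → ℝ} (he : e = α * d) (ht : ∀ l, t l = u l * d) (ho : ∀ l, o l = α * u l * d) :
    -(1 / (N : ℝ)) * ∑ i ∈ Finset.Icc j k, (S (k + 1) - S i) * d
        - ∑ l, P l * (o l - ((j : ℝ) - 1) / N * t l)
        + S (k + 1) * (e - ((j : ℝ) - 1) / N * d)
      = -cellCost N S (totalLoad P u) α j k * d := by
  have h1 : ∑ l, P l * (o l - ((j : ℝ) - 1) / N * t l)
      = totalLoad P u * ((α - ((j : ℝ) - 1) / N) * d) := by
    rw [totalLoad, Finset.sum_mul]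
    exact Finset.sum_congr rfl fun l _ => by rw [ht, ho]; ring
  rw [h1, he, ← Finset.sum_mul, cellCost]
  ring

theorem sum_sum_eq_single {N j₀ k₀ : ℕ} (hj : j₀ ∈ Finset.Icc 1 N)
    (hk : k₀ ∈ Finset.Icc (j₀ - 1) (N - 1)) {Δ : ℕ → ℕ → ℝ} (h1 : Δ j₀ k₀ = 1)
    (h0 : ∀ j ∈ Finset.Icc 1 N, ∀ k ∈ Finset.Icc (j - 1) (N - 1), (j, k) ≠ (j₀, k₀) → Δ j k = 0)
    (F : ℕ → ℕ → ℝ) :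
    ∑ j ∈ Finset.Icc 1 N, ∑ k ∈ Finset.Icc (j - 1) (N - 1), F j k * Δ j k = F j₀ k₀ := by
  rw [Finset.sum_eq_single_of_mem j₀ hj, Finset.sum_eq_single_of_mem k₀ hk, h1, mul_one]
  · intro k hk' hne
    rw [h0 j₀ hj k hk' (by simpa using hne), mul_zero]
  · intro j hj' hne
    refine Finset.sum_eq_zero fun k hk' => ?_
    rw [h0 j hj' k hk' (by simp [hne]), mul_zero]

/-- The selection constraint: binary variables that sum to one single out a cell. -/
theorem exists_single_of_sum_sum_eq_one {N : ℕ} {Δ : ℕ → ℕ → ℝ}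
    (hb : ∀ j ∈ Finset.Icc 1 N, ∀ k ∈ Finset.Icc (j - 1) (N - 1), Δ j k = 0 ∨ Δ j k = 1)
    (hs : ∑ j ∈ Finset.Icc 1 N, ∑ k ∈ Finset.Icc (j - 1) (N - 1), Δ j k = 1) :
    ∃ j₀ ∈ Finset.Icc 1 N, ∃ k₀ ∈ Finset.Icc (j₀ - 1) (N - 1), Δ j₀ k₀ = 1 ∧
      ∀ j ∈ Finset.Icc 1 N, ∀ k ∈ Finset.Icc (j - 1) (N - 1), (j, k) ≠ (j₀, k₀) → Δ j k = 0 := by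
  rw [Finset.sum_sigma'] at hs
  obtain ⟨⟨j₀, k₀⟩, hx, hne⟩ := Finset.exists_ne_zero_of_sum_ne_zero (hs.trans_ne one_ne_zero)
  have hmem := Finset.mem_sigma.mp hx
  have h1 := (hb j₀ hmem.1 k₀ hmem.2).resolve_left hne
  refine ⟨j₀, hmem.1, k₀, hmem.2, h1, fun j hj k hk hjk => ?_⟩
  rw [← Finset.add_sum_erase _ _ hx, h1, add_eq_left] at hs
  refine (Finset.sum_eq_zero_iff_of_nonneg fun y hy => ?_).mp hs ⟨j, k⟩ ?_
  · have hy' := Finset.mem_sigma.mp (Finset.mem_of_mem_erase hy)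
    rcases hb _ hy'.1 _ hy'.2 with h | h <;> rw [h] <;> norm_num
  · refine Finset.mem_erase.mpr ⟨fun h => hjk ?_, Finset.mem_sigma.mpr ⟨hj, hk⟩⟩
    simpa using h

/-- The system with its auxiliary variables eliminated: a cell `(j, k)` that locates `α` and the
load, and on which the budget inequality holds. -/
theorem exists_adjustableMILP_iff {H N : ℕ} (P : Fin H → ℝ) (S : ℕ → ℝ) (δ : ℝ) {u : Fin H → ℝ}
    (hu : ∀ l, u l = 0 ∨ u l = 1) {α : ℝ} (hα0 : 0 ≤ α) (hα1 : α ≤ 1) :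
    (∃ (Δ ε : ℕ → ℕ → ℝ) (τ o : Fin H → ℕ → ℕ → ℝ), AdjustableMILP N P S δ u α Δ ε τ o) ↔
      ∃ j ∈ Finset.Icc 1 N, ∃ k ∈ Finset.Icc (j - 1) (N - 1),
        (k : ℝ) ≤ α * N ∧ α * N ≤ k + 1 ∧ S j ≤ totalLoad P u ∧ totalLoad P u ≤ S (j - 1) ∧
        δ ≤ cellCost N S (totalLoad P u) α j k := by
  constructor
  · rintro ⟨Δ, ε, τ, o, h⟩
    obtain ⟨j, hj, k, hk, h1, h0⟩ := exists_single_of_sum_sum_eq_one h.binary h.select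
    have hsum := sum_sum_eq_single hj hk h1 h0
    refine ⟨j, hj, k, hk, ?_, ?_, ?_, ?_, ?_⟩
    · exact (hsum fun _ k => (k : ℝ)).symm.trans_le h.risk_lower
    · exact h.risk_upper.trans_eq (hsum fun _ k => (k : ℝ) + 1)
    · exact (hsum fun j _ => S j).symm.trans_le h.load_lower
    · exact h.load_upper.trans_eq (hsum fun j _ => S (j - 1))
    · have hc := h.cvar
      rw [Finset.sum_congr rfl fun j hj => Finset.sum_congr rfl fun k hk =>
        have hpr := h.products_eq hu hj hk
        budget_term_eq P u S α (Δ j k) j k hpr.1 (fun l => (hpr.2 l).1) fun l => (hpr.2 l).2,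
        hsum fun j k => -cellCost N S (totalLoad P u) α j k] at hc
      linarith
  · rintro ⟨j, hj, k, hk, hk1, hk2, hl1, hl2, hc⟩
    set Δ : ℕ → ℕ → ℝ := fun j' k' => if (j', k') = (j, k) then 1 else 0 with hΔ
    have h1 : Δ j k = 1 := if_pos rfl
    have hsum := sum_sum_eq_single hj hk h1 fun j' _ k' _ hne => if_neg hne
    have hb : ∀ j' k', Δ j' k' = 0 ∨ Δ j' k' = 1 := fun j' k' => by
      simp only [hΔ]; split_ifs <;> simp
    refine ⟨Δ, fun j k => α * Δ j k, fun l j k => u l * Δ j k, fun l j k => α * u l * Δ j k,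
      ?_, ?_, ?_, ?_, ?_, ?_, ?_, ?_, ?_, fun j' _ k' _ => hb j' k'⟩
    · rw [Finset.sum_congr rfl fun j _ => Finset.sum_congr rfl fun k _ =>
        budget_term_eq P u S α (Δ j k) j k rfl (fun l => rfl) fun l => rfl,
        hsum fun j k => -cellCost N S (totalLoad P u) α j k]
      linarith
    · simpa using hsum fun _ _ => 1
    · rw [hsum fun _ k => (k : ℝ)]; exact hk1
    · rw [hsum fun _ k => (k : ℝ) + 1]; exact hk2
    · rw [hsum fun j _ => S j]; exact hl1
    · rw [hsum fun j _ => S (j - 1)]; exact hl2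
    · intro j' _ k' _
      rcases hb j' k' with h | h <;> rw [h] <;> refine ⟨?_, ?_, ?_, ?_⟩ <;> linarith
    · intro j' _ k' _ l
      rcases hb j' k' with h | h <;> rcases hu l with h' | h' <;> rw [h, h'] <;>
        refine ⟨?_, ?_, ?_, ?_⟩ <;> linarith
    · intro j' _ k' _ l
      rcases hb j' k' with h | h <;> rcases hu l with h' | h' <;> rw [h, h'] <;>
        refine ⟨?_, ?_, ?_, ?_⟩ <;> linarith

/-- If `S j ≤ L ≤ S (j - 1)` then the samples that contribute to the cost are those of index at
least `j`. -/
theorem cellCost_eq_tailCost {N : ℕ} (hN : 0 < N) {S : ℕ → ℝ}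
    (hanti : ∀ i j, i ≤ j → j < N → S (j + 1) ≤ S (i + 1)) {L : ℝ} (α : ℝ) {j k : ℕ} (hj : 1 ≤ j)
    (hjk : j ≤ k + 1) (hk : k < N) (hl : S j ≤ L) (hu : j ≠ 1 → L ≤ S (j - 1)) :
    cellCost N S L α j k = tailCost N S L α k := by
  have hanti' : ∀ a b, 1 ≤ a → a ≤ b → b ≤ N → S b ≤ S a := fun a b ha hab hb => by
    obtain ⟨a, rfl⟩ := Nat.exists_eq_add_of_le' ha
    obtain ⟨b, rfl⟩ := Nat.exists_eq_add_of_le' (ha.trans hab)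
    exact hanti a b (by omega) (by omega)
  have hsum : ∑ i ∈ Finset.range k, max 0 (L - S (i + 1))
      = (k + 1 - j) * (L - S (k + 1)) + ∑ i ∈ Finset.Icc j k, (S (k + 1) - S i) := by
    have h1 : ∑ i ∈ Finset.range k, max 0 (L - S (i + 1))
        = ∑ i ∈ Finset.Icc 1 k, max 0 (L - S i) := by
      rw [Finset.range_eq_Ico, Finset.sum_Ico_add' (fun i => max 0 (L - S i)) 0 k 1]
      rfl
    have h2 : ∑ i ∈ Finset.Icc j k, max 0 (L - S i) = ∑ i ∈ Finset.Icc 1 k, max 0 (L - S i) := by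
      refine Finset.sum_subset (Finset.Icc_subset_Icc_left hj) fun i hi hi' => ?_
      simp only [Finset.mem_Icc] at hi hi'
      have := hanti' i (j - 1) hi.1 (by omega) (by omega)
      exact max_eq_left (by linarith [hu (by omega)])
    have h3 : ∑ i ∈ Finset.Icc j k, max 0 (L - S i)
        = ∑ i ∈ Finset.Icc j k, ((L - S (k + 1)) + (S (k + 1) - S i)) := by
      refine Finset.sum_congr rfl fun i hi => ?_
      simp only [Finset.mem_Icc] at hi
      have := hanti' j i hj hi.1 (by omega)
      rw [max_eq_right (by linarith)]; ring
    rw [h1, ← h2, h3, Finset.sum_add_distrib, Finset.sum_const, Nat.card_Icc, nsmul_eq_mul,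
      Nat.cast_sub hjk, Nat.cast_add, Nat.cast_one]
  have hmax : max 0 (L - S (k + 1)) = L - S (k + 1) :=
    max_eq_right (by linarith [hanti' j (k + 1) hj hjk hk])
  have hNR : (N : ℝ) ≠ 0 := by exact_mod_cast hN.ne'
  rw [tailCost, hsum, hmax, cellCost]
  field_simp
  ring

theorem exists_cell_iff_exists_le_tailCost {N : ℕ} (hN : 0 < N) {S : ℕ → ℝ}
    (hanti : ∀ i j, i ≤ j → j < N → S (j + 1) ≤ S (i + 1)) {L : ℝ} (hL : L ≤ S 0) {α δ : ℝ}
    (hδ : 0 < δ) :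
    (∃ j ∈ Finset.Icc 1 N, ∃ k ∈ Finset.Icc (j - 1) (N - 1), (k : ℝ) ≤ α * N ∧ α * N ≤ k + 1 ∧
        S j ≤ L ∧ L ≤ S (j - 1) ∧ δ ≤ cellCost N S L α j k) ↔
      ∃ k < N, (k : ℝ) ≤ α * N ∧ α * N ≤ k + 1 ∧ δ ≤ tailCost N S L α k := by
  constructor
  · rintro ⟨j, hj, k, hk, h1, h2, h3, h4, h5⟩
    rw [Finset.mem_Icc] at hj hk
    rw [cellCost_eq_tailCost hN hanti α hj.1 (by omega) (by omega) h3 fun _ => h4] at h5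
    exact ⟨k, by omega, h1, h2, h5⟩
  · rintro ⟨k, hk, h1, h2, h3⟩
    -- a positive cost means that some sample up to `k + 1` lies below `L`; take the first one
    have hex : ∃ i, i ≤ k ∧ S (i + 1) < L := by
      by_contra! hge
      have : tailCost N S L α k = 0 := by
        rw [tailCost, Finset.sum_eq_zero fun i hi => max_eq_left
          (sub_nonpos.mpr (hge i (Finset.mem_range.mp hi).le)),
          max_eq_left (sub_nonpos.mpr (hge k le_rfl))]
        ring
      linarith
    classical
    obtain ⟨hik, hi⟩ := Nat.find_spec hex
    have hmin := fun i => Nat.find_min hex (m := i)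
    set i := Nat.find hex
    have hprev : i ≠ 0 → L ≤ S i := fun h0 => by
      by_contra! hlt
      refine hmin (i - 1) (by omega) ⟨by omega, ?_⟩
      rwa [Nat.sub_add_cancel (by omega)]
    refine ⟨i + 1, Finset.mem_Icc.mpr ⟨by omega, by omega⟩, k, Finset.mem_Icc.mpr
      ⟨by omega, by omega⟩, h1, h2, hi.le, ?_, ?_⟩
    · rcases eq_or_ne i 0 with h | h
      · rw [h]; exact hL
      · exact hprev h
    · rwa [cellCost_eq_tailCost hN hanti α (by omega) (by omega) hk hi.le
        fun h => hprev (by omega)]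

theorem theorem5 {N m H : ℕ} (hN : 0 < N) (hm : 0 < m)
    -- the norm on `ℝᵐ` in the Wasserstein distance
    (p : Seminorm ℝ (Fin m → ℝ)) (hp : ∀ x, p x = 0 → x = 0)
    -- the samples, the radius, the loads of the units, and a non-increasing ordering of the samples
    (ξ : Fin N → Fin m → ℝ) (δ : ℝ) (hδ : 0 < δ)
    (P : Fin H → ℝ) (hP : ∀ l, 0 ≤ P l)
    (σ : Equiv.Perm (Fin N)) (hσ : Antitone fun n => ∑ i, ξ (σ n) i)
    -- the smallest total output is below the maximum load
    (hmax : sortedTotal P ξ σ 0 > sortedTotal P ξ σ N)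
    -- the decisions
    (u : Fin H → ℝ) (hu : ∀ l, u l = 0 ∨ u l = 1) (α : ℝ) (hα0 : 0 ≤ α) (hα1 : α < 1) :
    (DRChanceConstraint p ξ δ P u α ↔
      ∃ (Δ ε : ℕ → ℕ → ℝ) (τ o : Fin H → ℕ → ℕ → ℝ),
        AdjustableMILP N P (sortedTotal P ξ σ) (dualNorm p (fun _ => 1) * δ) u α Δ ε τ o) ∧
    ∀ (Δ ε : ℕ → ℕ → ℝ) (τ o : Fin H → ℕ → ℕ → ℝ),
      AdjustableMILP N P (sortedTotal P ξ σ) (dualNorm p (fun _ => 1) * δ) u α Δ ε τ o →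
      ∀ j ∈ Finset.Icc 1 N, ∀ k ∈ Finset.Icc (j - 1) (N - 1),
        ε j k = α * Δ j k ∧ ∀ l, τ l j k = u l * Δ j k ∧ o l j k = α * u l * Δ j k := by
  refine ⟨?_, fun Δ ε τ o h j hj k hk => h.products_eq hu hj hk⟩
  have hD := dualNorm_one_pos hm p hp
  have hS : ∀ n : Fin N, sortedTotal P ξ σ (n + 1) = ∑ i, (ξ ∘ σ) n i := fun n => by
    simp [sortedTotal]
  have hanti : ∀ i j, i ≤ j → j < N → sortedTotal P ξ σ (j + 1) ≤ sortedTotal P ξ σ (i + 1) :=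
    fun i j hij hj => by
      rw [hS ⟨j, hj⟩, hS ⟨i, hij.trans_lt hj⟩]
      exact hσ (Fin.mk_le_mk.mpr hij)
  have hL : totalLoad P u ≤ sortedTotal P ξ σ 0 := Finset.sum_le_sum fun l _ =>
    mul_le_of_le_one_right (hP l) (by rcases hu l with h | h <;> rw [h] <;> norm_num)
  have hperm : DRChanceConstraint p ξ δ P u α ↔ DRChanceConstraint p (ξ ∘ σ) δ P u α := by
    unfold DRChanceConstraint wassersteinAmbiguitySet
    rw [empiricalMeasure_comp_perm]
  rw [hperm, drChanceConstraint_iff_le_tailCost hN p hp (ξ ∘ σ) hS hanti hδ hD P u hα0 hα1,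
    exists_adjustableMILP_iff P _ _ hu hα0 hα1.le,
    exists_cell_iff_exists_le_tailCost hN hanti hL (mul_pos hD hδ)]
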